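/- Let $q$ be a prime power, $k>1$ an integer, $F=\mathbb F_q$, $L=\mathbb F_{q^{2^k}}\supset F$, and let $M$ be the subfield of $L$ of order $q^{2^{k-1}}$. Represent $\mathrm{PG}(2^k-1,q)$ as the projective space of the $F$-vector space $L$, with points $Fx$, $x\in L\setminus\{0\}$, and let $j(Fx)=Fx^{-1}$. The Desarguesian spread $\mathcal S$ is the set of the projective subspaces with underlying vector spaces $Mz$, $z\in L\setminus\{0\}$. A set of points is scattered with respect to $\mathcal S$ if it meets each element of $\mathcal S$ in at most one point. A line spread is a partition of the point set into lines. A rational curve of order $n$ in $\mathrm{PG}(r,q)$ is a set of points $\{F(g_0(t_0,t_1),\ldots,g_r(t_0,t_1)) : (t_0,t_1)\in F^2\setminus\{(0,0)\}\}$, in some system of homogeneous coordinates, where $g_0,\dots,g_r$ are binary forms of degree $n$ over $F$ with highest common factor $1$; it is normal if it is not the projection, from a point not on it, of a rational curve of order $n$ of $\mathrm{PG}(r+1,q)$ that is not contained in a hyperplane. A normal rational curve of degree $d$ is a normal rational curve whose smallest order is $d$ and whose span has projective dimension $d$. Then there is a line spread $\mathcal F$ of $\mathrm{PG}(2^k-1,q)$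 all of whose lines are scattered with respect to $\mathcal S$. Moreover, for every such line spread $\mathcal F$, the family $\{j(\ell):\ell\in\mathcal F\}$ is a partition of the point set of $\mathrm{PG}(2^k-1,q)$, and 1. if $q\ge 2^k-1$, then each $j(\ell)$, $\ell\in\mathcal F$, is a normal rational curve of degree $2^k-1$; 2. if $q<2^k-1$, then each $j(\ell)$, $\ell\in\mathcal F$, consists of $q+1$ independent points. In particular, $\mathrm{PG}(2^k-1,q)$ has a partition into normal rational curves of degree $2^k-1$ if $q\ge 2^k-1$, and a partition into $(q+1)$-tuples of independent points if $q<2^k-1$. -/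

import Mathlib

open scoped LinearAlgebra.Projectivization

namespace FieldInversion

section General

variable {F V : Type*} [Field F] [AddCommGroup V] [Module F V]

/-- The set of points of the projective subspace given by a linear subspace `W`. -/
def pointsOf (W : Submodule F V) : Set (ℙ F V) :=
  {P | P.submodule ≤ W}

/-- A line of the projective space of `V`, as a set of points. -/
def IsLine (l : Set (ℙ F V)) : Prop :=
  ∃ W : Submodule F V, Module.finrank F W = 2 ∧ l = pointsOf W

/-- A line spread: a set of lines such that every point lies on exactly one of them. -/
def IsLineSpread (S : Set (Set (ℙ F V))) : Prop :=
  (∀ l ∈ S, IsLine l) ∧ Setoid.IsPartition S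

/-- A set of points is scattered with respect to a spread if it meets every element of the
spread in at most one point. -/
def IsScattered (A : Set (ℙ F V)) (S : Set (Set (ℙ F V))) : Prop :=
  ∀ B ∈ S, (A ∩ B).Subsingleton

/-- The linear subspace spanned by a set of points. -/
def pointSpan (C : Set (ℙ F V)) : Submodule F V :=
  ⨆ P ∈ C, P.submodule

/-- `C` is a rational curve of order `n`: in some system of homogeneous coordinates it is the set
of the points `F (g₀(t₀, t₁), …, gᵣ(t₀, t₁))` for binary forms `gᵢ` of degree `n`
without nonconstant common factor. -/
def IsRationalCurve (n : ℕ) (C : Set (ℙ F V)) : Prop :=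
  ∃ (r : ℕ) (b : Module.Basis (Fin (r + 1)) F V) (g : Fin (r + 1) → MvPolynomial (Fin 2) F),
    (∀ i, (g i).IsHomogeneous n) ∧
    (∀ p : MvPolynomial (Fin 2) F, (∀ i, p ∣ g i) → IsUnit p) ∧
    C = {P | ∃ t : Fin 2 → F, t ≠ 0 ∧
      P.submodule = Submodule.span F {∑ i, MvPolynomial.eval t (g i) • b i}}

/-- `C` is the projection, from a point not on `C'`, of a set of points `C'` of a projective space
of dimension one more. The centre is the kernel of `π`. -/
def IsProjectionOf {V' : Type*} [AddCommGroup V'] [Module F V']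
    (C : Set (ℙ F V)) (C' : Set (ℙ F V')) : Prop :=
  ∃ π : V' →ₗ[F] V, Function.Surjective π ∧ Module.finrank F (LinearMap.ker π) = 1 ∧
    (∀ P' ∈ C', P'.submodule ≠ LinearMap.ker π) ∧
    C = {P | ∃ P' ∈ C', P.submodule = P'.submodule.map π}

/-- A rational curve `C` of order `n` is normal if it is not the projection of a rational curve of
the same order that lies in a projective space of dimension one more and spans it. -/
def IsNormalRationalCurve (n : ℕ) (C : Set (ℙ F V)) : Prop :=
  IsRationalCurve n C ∧
    ¬ ∃ C' : Set (ℙ F (Fin (Module.finrank F V + 1) → F)),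
      IsRationalCurve n C' ∧ pointSpan C' = ⊤ ∧ IsProjectionOf C C'

/-- A normal rational curve of degree `d`: `d` is the smallest of its orders and is the projective
dimension of its span. -/
def IsNRCOfDegree (d : ℕ) (C : Set (ℙ F V)) : Prop :=
  IsLeast {n | IsNormalRationalCurve n C} d ∧ Module.finrank F (pointSpan C) = d + 1

/-- `C` consists of `m` independent points. -/
def IsIndependentTuple (m : ℕ) (C : Set (ℙ F V)) : Prop :=
  C.ncard = m ∧ Projectivization.Independent (fun P : C => (P : ℙ F V))

end General

section Extension

variable {F L : Type*} [Field F] [Field L] [Algebra F L]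

/-- The inversion map `F x ↦ F x⁻¹` on the points of the projective space of `L` over `F`. -/
def inversion : ℙ F L → ℙ F L :=
  Projectivization.lift
    (fun x : {v : L // v ≠ 0} => Projectivization.mk F (x : L)⁻¹ (inv_ne_zero x.2)) (by
      intro a b t hab
      have ht : t ≠ 0 := by
        rintro rfl
        exact a.2 (by simpa using hab)
      refine (Projectivization.mk_eq_mk_iff' F _ _ _ _).2 ⟨t⁻¹, ?_⟩
      simp only [hab, Algebra.smul_def, mul_inv, map_inv₀])

/-- The defining formula of the inversion map. -/
theorem inversion_mk (x : L) (hx : x ≠ 0) :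
    inversion (Projectivization.mk F x hx) = Projectivization.mk F x⁻¹ (inv_ne_zero hx) :=
  rfl

/-- The Desarguesian spread of an intermediate field `M`: its elements are the projective
subspaces over `F` that underlie the one-dimensional `M`-subspaces `M z` of `L`, for `z ≠ 0`. -/
def desarguesianSpread (M : IntermediateField F L) : Set (Set (ℙ F L)) :=
  {S | ∃ z : L, z ≠ 0 ∧ S = pointsOf ((Submodule.span M {z}).restrictScalars F)}

/-- The images under the inversion map of the members of a family of point sets. -/
def inversionImage (S : Set (Set (ℙ F L))) : Set (Set (ℙ F L)) :=
  (fun l => inversion '' l) '' S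

end Extension

end FieldInversion

/-!
Let `l` be the line through `F a` and `F b`, and let `θ = b / a`. Its points other than `F a` are
the `F (s - θ) a` with `s ∈ F`. Since `(s - θ) * minpolyDiv F θ` takes the value
`minpoly F θ (s) ∈ F` at `s`, inversion maps these points to the values at `s` of the polynomial
`a⁻¹ * minpolyDiv F θ`, whose coefficients form a basis of `L` over `F` when `θ` generates `L`.
In that basis the image of `l` is the moment curve `s ↦ (1, s, …, s ^ d)` with the point at
infinity added, any `d + 1` points of which are independent. If `l` is scattered with respect to
the spread of `M`, then `θ ∉ M`; as the subfields of `L` over `F` form a chain, `θ` generates `L`.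

Scattered line spreads are constructed by induction along the chain of subfields. Let `σ` be an
involution of `M` with fixed field `M₀`, and let `J` be a `σ`-semilinear map of the plane `L` over
`M` without eigenvectors. Then `m (v + J v) = r v + J (r v)` with `v ≠ 0` forces `m = r = σ r`, so
`v ↦ v + J v` maps every `M`-line to an `F`-subspace that meets each `M`-line in at most a
one-dimensional `M₀`-subspace. Copying a scattered spread of `M` with respect to `M₀` into each of
these images gives one of `L` with respect to `M`.
-/

namespace FieldInversion

open Module

section Points

variable {F V : Type*} [Field F] [AddCommGroup V] [Module F V]

theorem mk_mem_pointsOf {W : Submodule F V} {v : V} (hv : v ≠ 0) :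
    Projectivization.mk F v hv ∈ pointsOf W ↔ v ∈ W := by
  rw [pointsOf, Set.mem_ofPred_eq, Projectivization.submodule_mk,
    Submodule.span_singleton_le_iff_mem]

theorem submodule_eq_span_singleton_iff {P : ℙ F V} {v : V} (hv : v ≠ 0) :
    P.submodule = Submodule.span F {v} ↔ P = Projectivization.mk F v hv := by
  rw [← Projectivization.submodule_mk v hv, Projectivization.submodule_injective.eq_iff]

theorem mk_smul_eq_mk {v : V} {c : F} (hv : v ≠ 0) (hcv : c • v ≠ 0) :
    Projectivization.mk F (c • v) hcv = Projectivization.mk F v hv :=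
  (Projectivization.mk_eq_mk_iff' F _ _ _ _).2 ⟨c, rfl⟩

theorem IsLine.exists_eq_pointsOf_span_pair {l : Set (ℙ F V)} (hl : IsLine l) :
    ∃ a b : V, LinearIndependent F ![a, b] ∧ l = pointsOf (Submodule.span F {a, b}) := by
  obtain ⟨W, hW, rfl⟩ := hl
  have : Module.Finite F W := Module.finite_of_finrank_pos (by omega)
  let e := finBasisOfFinrankEq F W hW
  have he : ![(e 0 : V), (e 1 : V)] = W.subtype ∘ e := by
    ext i
    fin_cases i <;> rfl
  have hspan : Submodule.span F {(e 0 : V), (e 1 : V)} = W := by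
    rw [← Matrix.range_cons_cons_empty _ _ ![], he, Set.range_comp, ← Submodule.map_span,
      e.span_eq, Submodule.map_top, Submodule.range_subtype]
  exact ⟨e 0, e 1, he ▸ e.linearIndependent.map' W.subtype W.ker_subtype, by rw [hspan]⟩

theorem pointsOf_span_pair {a b : V} (ha : a ≠ 0) (hb : ∀ s : F, s • a - b ≠ 0) :
    pointsOf (Submodule.span F {a, b}) = insert (Projectivization.mk F a ha)
      (Set.range fun s => Projectivization.mk F (s • a - b) (hb s)) := by
  ext P
  induction P with | h v hv =>
  rw [mk_mem_pointsOf, Submodule.mem_span_pair]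
  simp only [Set.mem_insert_iff, Set.mem_range, eq_comm (b := Projectivization.mk F v hv),
    Projectivization.mk_eq_mk_iff']
  constructor
  · rintro ⟨x, y, rfl⟩
    by_cases hy : y = 0
    · exact Or.inl ⟨x, by simp [hy]⟩
    · refine Or.inr ⟨-(x / y), -y, ?_⟩
      rw [smul_sub, smul_smul, neg_mul_neg, mul_div_cancel₀ _ hy, neg_smul, sub_neg_eq_add]
  · rintro (⟨x, rfl⟩ | ⟨s, x, rfl⟩)
    · exact ⟨x, 0, by simp⟩
    · exact ⟨x * s, -x, by rw [smul_sub, smul_smul, neg_smul, sub_eq_add_neg]⟩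

theorem isIndependentTuple_range {ι : Type*} {f : ι → ℙ F V}
    (hf : Projectivization.Independent f) :
    IsIndependentTuple (Nat.card ι) (Set.range f) := by
  rw [Projectivization.independent_iff] at hf
  have hinj : Function.Injective f := Function.Injective.of_comp hf.injective
  refine ⟨Set.ncard_range_of_injective hinj, ?_⟩
  rw [Projectivization.independent_iff,
    ← linearIndependent_equiv (Equiv.ofInjective f hinj)]
  exact hf

end Points

section RationalCurves

variable {F V : Type*} [Field F] [AddCommGroup V] [Module F V]

theorem eval_eq_sum_finsuppAntidiag {R σ : Type*} [CommSemiring R] [Fintype σ] [DecidableEq σ]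
    {n : ℕ} {g : MvPolynomial σ R} (hg : g.IsHomogeneous n) (t : σ → R) :
    MvPolynomial.eval t g =
      ∑ m ∈ Finset.univ.finsuppAntidiag n, g.coeff m * ∏ i, t i ^ m i := by
  rw [MvPolynomial.eval_eq']
  refine Finset.sum_subset (fun m hm => ?_) (fun m _ hm => ?_)
  · rw [Finset.mem_finsuppAntidiag]
    refine ⟨?_, Finset.subset_univ _⟩
    have hdeg : m.degree = n := by
      rw [Finsupp.degree_eq_weight_one]
      exact hg (MvPolynomial.mem_support_iff.1 hm)
    rwa [Finsupp.degree_eq_sum] at hdeg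
  · rw [MvPolynomial.notMem_support_iff.1 hm, zero_mul]

theorem IsRationalCurve.finrank_pointSpan_le {n : ℕ} {C : Set (ℙ F V)}
    (hC : IsRationalCurve n C) : finrank F (pointSpan C) ≤ n + 1 := by
  obtain ⟨r, b, g, hg, -, rfl⟩ := hC
  let exponents : Finset (Fin 2 →₀ ℕ) := Finset.univ.finsuppAntidiag n
  let w : exponents → V := fun m => ∑ i, (g i).coeff m • b i
  have hle : pointSpan {P : ℙ F V | ∃ t : Fin 2 → F, t ≠ 0 ∧
      P.submodule = Submodule.span F {∑ i, MvPolynomial.eval t (g i) • b i}} ≤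
      Submodule.span F (Set.range w) := by
    refine iSup₂_le fun P ⟨t, _, ht⟩ => ?_
    rw [ht, Submodule.span_singleton_le_iff_mem]
    have hw : ∑ i, MvPolynomial.eval t (g i) • b i =
        ∑ m : exponents, (∏ i, t i ^ (m : Fin 2 →₀ ℕ) i) • w m := by
      simp only [w, eval_eq_sum_finsuppAntidiag (hg _), Finset.smul_sum, Finset.sum_smul, smul_smul]
      rw [Finset.sum_comm, ← Finset.sum_coe_sort]
      simp only [mul_comm, exponents]
    rw [hw]
    exact Submodule.sum_mem _ fun m _ =>
      Submodule.smul_mem _ _ (Submodule.subset_span (Set.mem_range_self m))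
  have := Module.Finite.span_of_finite F (Set.finite_range w)
  calc finrank F (pointSpan _) ≤ finrank F (Submodule.span F (Set.range w)) :=
        Submodule.finrank_mono hle
    _ ≤ Fintype.card exponents := finrank_range_le_card w
    _ = n + 1 := by
        simp [exponents, Finset.card_finsuppAntidiag_nat_eq_choose, add_comm 1 n]

theorem IsRationalCurve.isNRCOfDegree {d : ℕ} {C : Set (ℙ F V)} (hC : IsRationalCurve d C)
    (hV : finrank F V = d + 1) (hspan : pointSpan C = ⊤) : IsNRCOfDegree d C := by
  have hfin : finrank F (pointSpan C) = d + 1 := by rw [hspan, finrank_top, hV]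
  refine ⟨⟨⟨hC, ?_⟩, fun n hn => ?_⟩, hfin⟩
  · rintro ⟨C', hC', htop, -⟩
    have h := hC'.finrank_pointSpan_le
    rw [htop, finrank_top, finrank_fin_fun, hV] at h
    omega
  · have h := hn.1.finrank_pointSpan_le
    omega

end RationalCurves

section MomentCurve

variable {F V : Type*} [Field F] [AddCommGroup V] [Module F V] {d : ℕ}
  (b : Basis (Fin (d + 1)) F V)

/-- The vectors representing the points of the moment curve of a basis `b`. The parameter runs
over the projective line `F ∪ {∞}`, encoded as `Option F` with `none` for `∞`. -/
noncomputable def momentVector (o : Option F) : V :=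
  o.elim (b (Fin.last d)) fun s => ∑ i : Fin (d + 1), s ^ (i : ℕ) • b i

theorem momentVector_none : momentVector b none = b (Fin.last d) :=
  rfl

theorem momentVector_some (s : F) :
    momentVector b (some s) = ∑ i : Fin (d + 1), s ^ (i : ℕ) • b i :=
  rfl

theorem momentVector_map {V' : Type*} [AddCommGroup V'] [Module F V'] (e : V ≃ₗ[F] V')
    (o : Option F) : momentVector (b.map e) o = e (momentVector b o) := by
  cases o <;> simp [momentVector_none, momentVector_some]

/-- The linear form whose coordinates are the coefficients of the polynomial `p`. For `p` of
degree at most `d`, its kernel meets the moment curve in the roots of `p`, with `∞` counted as a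
root when the degree is less than `d`. -/
noncomputable def coeffForm (p : Polynomial F) : Dual F V :=
  b.constr F fun i => p.coeff i

theorem coeffForm_momentVector_none (p : Polynomial F) :
    coeffForm b p (momentVector b none) = p.coeff d := by
  simp [coeffForm, momentVector_none]

theorem coeffForm_momentVector_some {p : Polynomial F} (hp : p.natDegree ≤ d) (s : F) :
    coeffForm b p (momentVector b (some s)) = p.eval s := by
  rw [Polynomial.eval_eq_sum_range' (Nat.lt_succ_of_le hp), ← Fin.sum_univ_eq_sum_range
    (fun i => p.coeff i * s ^ i)]
  simp [coeffForm, momentVector_some, mul_comm]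

theorem exists_dual_momentVector_ne_zero {o : Option F} {T : Finset (Option F)} (ho : o ∉ T)
    (hT : T.card ≤ d) :
    ∃ f : Dual F V, f (momentVector b o) ≠ 0 ∧ ∀ o' ∈ T, f (momentVector b o') = 0 := by
  set p : Polynomial F := ∏ t ∈ T.eraseNone, (Polynomial.X - Polynomial.C t)
  have hmonic : p.Monic := Polynomial.monic_prod_X_sub_C _ _
  have hdeg : p.natDegree = T.eraseNone.card :=
    Polynomial.natDegree_finsetProd_X_sub_C_eq_card _ _
  have hle : p.natDegree ≤ d := hdeg.trans_le (T.card_eraseNone_le.trans hT)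
  have hroot : ∀ t, some t ∈ T → p.eval t = 0 := fun t ht => by
    rw [Polynomial.eval_prod]
    exact Finset.prod_eq_zero (Finset.mem_eraseNone.2 ht) (by simp)
  rcases o with _ | s
  · let q := Polynomial.X ^ (d - p.natDegree) * p
    have hq : q.natDegree = d := by
      rw [(Polynomial.monic_X_pow _).natDegree_mul hmonic, Polynomial.natDegree_X_pow,
        Nat.sub_add_cancel hle]
    have hq1 : q.coeff d = 1 := by
      have := (Polynomial.monic_X_pow (R := F) (d - p.natDegree)).mul hmonic
      rwa [Polynomial.Monic, Polynomial.leadingCoeff, hq] at this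
    refine ⟨coeffForm b q, by simp [coeffForm_momentVector_none, hq1], ?_⟩
    rintro (_ | t) ht
    · exact absurd ht ho
    · simp [coeffForm_momentVector_some b hq.le, q, hroot t ht]
  · refine ⟨coeffForm b p, ?_, ?_⟩
    · rw [coeffForm_momentVector_some b hle, Polynomial.eval_prod, Finset.prod_ne_zero_iff]
      rintro t ht
      simp only [Polynomial.eval_sub, Polynomial.eval_X, Polynomial.eval_C, sub_ne_zero]
      rintro rfl
      exact ho (Finset.mem_eraseNone.1 ht)
    · rintro (_ | t) ht
      · have hlt : p.natDegree < d := by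
          rw [hdeg, Finset.card_eraseNone_of_mem ht]
          have := Finset.card_pos.2 ⟨_, ht⟩
          omega
        rw [coeffForm_momentVector_none, Polynomial.coeff_eq_zero_of_natDegree_lt hlt]
      · rw [coeffForm_momentVector_some b hle, hroot t ht]

theorem momentVector_ne_zero (o : Option F) : momentVector b o ≠ 0 := by
  obtain ⟨f, hf, -⟩ := exists_dual_momentVector_ne_zero b (Finset.notMem_empty o) (Nat.zero_le d)
  exact fun h => hf (by rw [h, map_zero])

theorem linearIndepOn_momentVector {T : Finset (Option F)} (hT : T.card ≤ d + 1) :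
    LinearIndepOn F (momentVector b) (T : Set (Option F)) := by
  classical
  have hdual (o : T) : ∃ f : Dual F V, f (momentVector b o) ≠ 0 ∧
      ∀ o' ∈ T.erase (o : Option F), f (momentVector b o') = 0 :=
    exists_dual_momentVector_ne_zero b (Finset.notMem_erase (o : Option F) T) (by
      rw [Finset.card_erase_of_mem o.2]
      omega)
  choose f hf hf0 using hdual
  refine LinearIndependent.of_pairwise_dual_eq_zero_one _
    (fun o => (f o (momentVector b o))⁻¹ • f o) (fun o o' hoo' => ?_) fun o => ?_
  · simp [hf0 o o' (Finset.mem_erase.2 ⟨Subtype.coe_ne_coe.2 hoo'.symm, o'.2⟩)]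
  · simp [inv_mul_cancel₀ (hf o)]

/-- The moment curve of a basis `b` of a space of dimension `d + 1`: the rational curve whose
binary forms are the monomials of degree `d`. -/
def momentCurve : Set (ℙ F V) :=
  Set.range fun o => Projectivization.mk F (momentVector b o) (momentVector_ne_zero b o)

theorem momentCurve_eq_insert : momentCurve b =
    insert (Projectivization.mk F _ (momentVector_ne_zero b none))
      (Set.range fun s => Projectivization.mk F _ (momentVector_ne_zero b (some s))) := by
  ext P
  simp [momentCurve, Option.exists, eq_comm]

theorem sum_monomial_smul_of_eq_zero {x y : F} (hy : y = 0) :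
    ∑ i : Fin (d + 1), (x ^ (i : ℕ) * y ^ (d - i)) • b i = x ^ d • momentVector b none := by
  rw [momentVector_none, Finset.sum_eq_single (Fin.last d)]
  · simp
  · intro i _ hi
    rw [hy, zero_pow (Nat.sub_ne_zero_of_lt (Fin.val_lt_last hi)), mul_zero, zero_smul]
  · simp

theorem sum_monomial_smul_of_ne_zero {x y : F} (hy : y ≠ 0) :
    ∑ i : Fin (d + 1), (x ^ (i : ℕ) * y ^ (d - i)) • b i =
      y ^ d • momentVector b (some (x / y)) := by
  rw [momentVector_some, Finset.smul_sum]
  refine Finset.sum_congr rfl fun i _ => ?_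
  rw [smul_smul, div_pow, ← pow_sub_mul_pow y i.is_le]
  field_simp

theorem mem_momentCurve_iff {P : ℙ F V} : P ∈ momentCurve b ↔ ∃ t : Fin 2 → F, t ≠ 0 ∧
    P.submodule =
      Submodule.span F {∑ i : Fin (d + 1), (t 0 ^ (i : ℕ) * t 1 ^ (d - i)) • b i} := by
  constructor
  · rintro ⟨_ | s, rfl⟩
    · refine ⟨![1, 0], by simp, ?_⟩
      rw [sum_monomial_smul_of_eq_zero b (by simp)]
      simp [Projectivization.submodule_mk]
    · refine ⟨![s, 1], by simp, ?_⟩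
      rw [sum_monomial_smul_of_ne_zero b (by simp)]
      simp [Projectivization.submodule_mk]
  · rintro ⟨t, ht, hP⟩
    by_cases h1 : t 1 = 0
    · have h0 : t 0 ≠ 0 := fun h0 => ht (by ext i; fin_cases i <;> assumption)
      have hne := smul_ne_zero (pow_ne_zero d h0) (momentVector_ne_zero b none)
      rw [sum_monomial_smul_of_eq_zero b h1, submodule_eq_span_singleton_iff hne] at hP
      exact ⟨none, by rw [hP, mk_smul_eq_mk]⟩
    · have hne := smul_ne_zero (pow_ne_zero d h1) (momentVector_ne_zero b (some (t 0 / t 1)))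
      rw [sum_monomial_smul_of_ne_zero b h1, submodule_eq_span_singleton_iff hne] at hP
      exact ⟨some (t 0 / t 1), by rw [hP, mk_smul_eq_mk]⟩

theorem isRationalCurve_momentCurve : IsRationalCurve d (momentCurve b) := by
  refine ⟨d, b, fun i => MvPolynomial.X 0 ^ (i : ℕ) * MvPolynomial.X 1 ^ (d - i), fun i => ?_,
    fun p hp => ?_, ?_⟩
  · have h := (MvPolynomial.isHomogeneous_X_pow (R := F) (0 : Fin 2) i).mul
      (MvPolynomial.isHomogeneous_X_pow (R := F) (1 : Fin 2) (d - i))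
    rwa [Nat.add_sub_cancel' i.is_le] at h
  · have h0 : p ∣ MvPolynomial.X 0 ^ d := by simpa using hp (Fin.last d)
    have h1 : p ∣ MvPolynomial.X 1 ^ d := by simpa using hp 0
    have hrel : IsRelPrime (MvPolynomial.X 0 : MvPolynomial (Fin 2) F) (MvPolynomial.X 1) := by
      rw [(MvPolynomial.X_prime (R := F) (i := (0 : Fin 2))).irreducible.isRelPrime_iff_not_dvd,
        MvPolynomial.X_dvd_X]
      simp
    exact hrel.pow h0 h1
  · ext P
    simp [mem_momentCurve_iff]

theorem pointSpan_momentCurve :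
    pointSpan (momentCurve b) = Submodule.span F (Set.range (momentVector b)) := by
  rw [pointSpan, momentCurve, iSup_range, Submodule.span_range_eq_iSup]
  simp only [Projectivization.submodule_mk]

theorem pointSpan_momentCurve_eq_top (hd : (d : ℕ∞) ≤ ENat.card F) :
    pointSpan (momentCurve b) = ⊤ := by
  obtain ⟨T, -, hT⟩ := Set.exists_subset_encard_eq (s := (Set.univ : Set F)) (by simpa using hd)
  obtain ⟨T, rfl⟩ := (Set.finite_of_encard_eq_coe hT).exists_finset_coe
  have hcard : T.insertNone.card = d + 1 := by
    rw [Set.encard_coe_eq_coe_finsetCard, Nat.cast_inj] at hT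
    rw [Finset.card_insertNone, hT]
  have : Nonempty (T.insertNone : Set (Option F)) := ⟨none, by simp⟩
  have htop := (linearIndepOn_momentVector b hcard.le).span_eq_top_of_card_eq_finrank (by
    simp [finrank_eq_card_basis b, hcard])
  rw [pointSpan_momentCurve, eq_top_iff, ← htop]
  exact Submodule.span_mono (by rintro _ ⟨o, rfl⟩; exact ⟨o, rfl⟩)

theorem isNRCOfDegree_momentCurve (hd : (d : ℕ∞) ≤ ENat.card F) :
    IsNRCOfDegree d (momentCurve b) :=
  (isRationalCurve_momentCurve b).isNRCOfDegree (by simp [finrank_eq_card_basis b])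
    (pointSpan_momentCurve_eq_top b hd)

theorem isIndependentTuple_momentCurve [Finite F] (hd : Nat.card F ≤ d) :
    IsIndependentTuple (Nat.card F + 1) (momentCurve b) := by
  have := Fintype.ofFinite F
  have hli : LinearIndependent F (momentVector b) := by
    rw [← linearIndepOn_univ_iff, ← Finset.coe_univ]
    exact linearIndepOn_momentVector b (by simpa [← Nat.card_eq_fintype_card] using hd)
  rw [← Finite.card_option]
  exact isIndependentTuple_range (.mk _ (momentVector_ne_zero b) hli)

end MomentCurve

section Subfields

variable {F L : Type*} [Field F] [Field L] [Algebra F L] [Finite L]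

theorem le_of_finrank_dvd_finrank {K M : IntermediateField F L}
    (h : finrank F K ∣ finrank F M) : K ≤ M := by
  have := Finite.of_injective _ (algebraMap F L).injective
  obtain ⟨f⟩ := FiniteField.nonempty_algHom_of_finrank_dvd h
  have hrange : (M.val.comp f).fieldRange = K := AlgHom.fieldRange_of_normal _
  intro x hx
  rw [← hrange] at hx
  obtain ⟨y, rfl⟩ := hx
  exact (f y).2

theorem adjoin_simple_eq_top_of_notMem {p k : ℕ} (hp : p.Prime)
    (hL : finrank F L = p ^ (k + 1)) {M : IntermediateField F L} (hM : finrank F M = p ^ k)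
    {x : L} (hx : x ∉ M) : IntermediateField.adjoin F {x} = ⊤ := by
  set K := IntermediateField.adjoin F {x}
  have hdvd : finrank F K ∣ p ^ (k + 1) := ⟨_, by rw [finrank_mul_finrank F K L, hL]⟩
  obtain ⟨j, hj, hKj⟩ := (Nat.dvd_prime_pow hp).1 hdvd
  have hjk : ¬ j ≤ k := fun hjk => by
    have hKM : K ≤ M := le_of_finrank_dvd_finrank (by rw [hKj, hM]; exact pow_dvd_pow p hjk)
    exact hx (hKM (IntermediateField.mem_adjoin_simple_self F x))
  obtain rfl : j = k + 1 := by omega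
  exact IntermediateField.eq_of_le_of_finrank_eq le_top
    (by rw [hKj, IntermediateField.finrank_top', hL])

end Subfields

section Inversion

variable {F L : Type*} [Field F] [Field L] [Algebra F L]

theorem inversion_involutive : Function.Involutive (inversion : ℙ F L → ℙ F L) := by
  intro P
  induction P with | h v hv =>
  simp only [inversion_mk, inv_inv]

theorem isPartition_inversionImage {S : Set (Set (ℙ F L))} (hS : Setoid.IsPartition S) :
    Setoid.IsPartition (inversionImage S) := by
  refine ⟨?_, fun P => ?_⟩
  · rintro ⟨l, hl, hl0⟩
    rw [Set.image_eq_empty] at hl0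
    exact hS.1 (hl0 ▸ hl)
  · obtain ⟨l, ⟨hl, hPl⟩, huniq⟩ := hS.2 (inversion P)
    refine ⟨inversion '' l, ⟨⟨l, hl, rfl⟩, _, hPl, inversion_involutive P⟩, ?_⟩
    rintro _ ⟨⟨l', hl', rfl⟩, Q, hQ, rfl⟩
    rw [inversion_involutive Q] at huniq
    rw [huniq l' ⟨hl', hQ⟩]

theorem isScattered_pointsOf_iff {W : Submodule F L} {M : IntermediateField F L} :
    IsScattered (pointsOf W) (desarguesianSpread M) ↔
      ∀ x ∈ W, x ≠ 0 → ∀ m ∈ M, m * x ∈ W → m ∈ (⊥ : IntermediateField F L) := by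
  constructor
  · intro h x hxW hx m hm hmxW
    rcases eq_or_ne m 0 with rfl | hm0
    · exact zero_mem _
    have hmx : m * x ≠ 0 := mul_ne_zero hm0 hx
    have heq : Projectivization.mk F (m * x) hmx = Projectivization.mk F x hx :=
      h _ ⟨x, hx, rfl⟩
        ⟨(mk_mem_pointsOf hmx).2 hmxW,
          (mk_mem_pointsOf hmx).2 (Submodule.mem_span_singleton.2 ⟨⟨m, hm⟩, rfl⟩)⟩
        ⟨(mk_mem_pointsOf hx).2 hxW,
          (mk_mem_pointsOf hx).2 (Submodule.mem_span_singleton_self x)⟩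
    obtain ⟨s, hs⟩ := (Projectivization.mk_eq_mk_iff' F _ _ _ _).1 heq
    exact IntermediateField.mem_bot.2 ⟨s, mul_right_cancel₀ hx (by rw [← hs, Algebra.smul_def])⟩
  · rintro h _ ⟨z, -, rfl⟩ P ⟨hPW, hPz⟩ Q ⟨hQW, hQz⟩
    induction P with | h x hx =>
    induction Q with | h y hy =>
    rw [mk_mem_pointsOf] at hPW hPz hQW hQz
    obtain ⟨m, rfl⟩ := Submodule.mem_span_singleton.1 hPz
    obtain ⟨n, rfl⟩ := Submodule.mem_span_singleton.1 hQz
    have hn : n ≠ 0 := by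
      rintro rfl
      exact hy (zero_smul M z)
    have hmn : ((m / n : M) : L) * (n • z) = m • z := by
      rw [← smul_eq_mul, ← IntermediateField.smul_def, smul_smul, div_mul_cancel₀ _ hn]
    obtain ⟨s, hs⟩ := IntermediateField.mem_bot.1
      (h _ hQW hy (m / n : M) (m / n : M).2 (hmn ▸ hPW))
    exact (Projectivization.mk_eq_mk_iff' F _ _ _ _).2 ⟨s, by rw [Algebra.smul_def, hs, hmn]⟩

theorem natDegree_minpolyDiv_add_one [FiniteDimensional F L] {θ : L}
    (hθ : IntermediateField.adjoin F {θ} = ⊤) : (minpolyDiv F θ).natDegree + 1 = finrank F L := by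
  rw [natDegree_minpolyDiv_succ (.of_finite F θ),
    (Field.primitive_element_iff_minpoly_natDegree_eq F θ).1 hθ]

theorem exists_basis_eq_coeff_minpolyDiv {d : ℕ} (hL : finrank F L = d + 1) {θ : L}
    (hθ : IntermediateField.adjoin F {θ} = ⊤) :
    ∃ c : Basis (Fin (d + 1)) F L, ∀ i, c i = (minpolyDiv F θ).coeff i := by
  have : FiniteDimensional F L := finite_of_finrank_pos (by omega)
  have hint : IsIntegral F θ := .of_finite F θ
  have hdeg := natDegree_minpolyDiv_add_one hθ
  have htop : ⊤ ≤ Submodule.span F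
      (Set.range fun i : Fin (d + 1) => (minpolyDiv F θ).coeff i) := by
    have hadjoin : Algebra.adjoin F {θ} = ⊤ := by
      rw [← IntermediateField.adjoin_simple_toSubalgebra_of_isAlgebraic hint.isAlgebraic, hθ,
        IntermediateField.top_toSubalgebra]
    rw [← Algebra.top_toSubmodule, ← hadjoin, ← span_coeff_minpolyDiv hint, Submodule.span_le]
    rintro _ ⟨i, rfl⟩
    by_cases hi : i < d + 1
    · exact Submodule.subset_span ⟨⟨i, hi⟩, rfl⟩
    · rw [Polynomial.coeff_eq_zero_of_natDegree_lt (by omega)]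
      exact zero_mem _
  exact ⟨basisOfTopLeSpanOfCardEqFinrank _ htop (by simp [hL]), fun i => by simp⟩

theorem exists_basis_momentVector_mul_eq {d : ℕ} (hL : finrank F L = d + 1) {θ : L}
    (hθ : IntermediateField.adjoin F {θ} = ⊤) :
    ∃ c : Basis (Fin (d + 1)) F L, momentVector c none = 1 ∧
      ∀ s, momentVector c (some s) * (algebraMap F L s - θ) =
        algebraMap F L ((minpoly F θ).eval s) := by
  have : FiniteDimensional F L := finite_of_finrank_pos (by omega)
  have hdeg : (minpolyDiv F θ).natDegree = d :=
    Nat.add_right_cancel ((natDegree_minpolyDiv_add_one hθ).trans hL)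
  obtain ⟨c, hc⟩ := exists_basis_eq_coeff_minpolyDiv hL hθ
  refine ⟨c, ?_, fun s => ?_⟩
  · have hmonic := minpolyDiv_monic (.of_finite F θ)
    rwa [Polynomial.Monic, Polynomial.leadingCoeff, hdeg, ← Fin.val_last d, ← hc] at hmonic
  · have hval : momentVector c (some s) = (minpolyDiv F θ).eval (algebraMap F L s) := by
      rw [Polynomial.eval_eq_sum_range' (hdeg.trans_lt d.lt_succ_self), ← Fin.sum_univ_eq_sum_range
        (fun i => (minpolyDiv F θ).coeff i * algebraMap F L s ^ i), momentVector_some]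
      simp only [hc, Algebra.smul_def, map_pow, mul_comm]
    calc momentVector c (some s) * (algebraMap F L s - θ)
        = (minpolyDiv F θ * (Polynomial.X - Polynomial.C θ)).eval (algebraMap F L s) := by
          simp [hval]
      _ = algebraMap F L ((minpoly F θ).eval s) := by
          rw [minpolyDiv_spec, Polynomial.eval_map_algebraMap,
            Polynomial.aeval_algebraMap_apply_eq_algebraMap_eval]

theorem exists_inversion_image_eq_momentCurve {d : ℕ} (hL : finrank F L = d + 1) {a b : L}
    (hab : LinearIndependent F ![a, b]) (hθ : IntermediateField.adjoin F {b / a} = ⊤) :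
    ∃ c : Basis (Fin (d + 1)) F L,
      inversion '' pointsOf (Submodule.span F {a, b}) = momentCurve c := by
  have ha : a ≠ 0 := hab.ne_zero 0
  have hb (s : F) : s • a - b ≠ 0 := fun hs =>
    neg_ne_zero.2 one_ne_zero (LinearIndependent.pair_iff.1 hab s (-1)
      (by rw [neg_one_smul, ← sub_eq_add_neg, hs])).2
  obtain ⟨c, hc_none, hc_some⟩ := exists_basis_momentVector_mul_eq hL hθ
  let scale : L ≃ₗ[F] L :=
    (LinearEquiv.smulOfNeZero L L a⁻¹ (inv_ne_zero ha)).restrictScalars F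
  have hscale (o : Option F) : momentVector (c.map scale) o = a⁻¹ * momentVector c o :=
    momentVector_map c scale o
  have hnone : momentVector (c.map scale) none = a⁻¹ := by rw [hscale, hc_none, mul_one]
  have hsome (s : F) :
      momentVector (c.map scale) (some s) = (minpoly F (b / a)).eval s • (s • a - b)⁻¹ := by
    rw [hscale, Algebra.smul_def, ← hc_some, eq_mul_inv_iff_mul_eq₀ (hb s), Algebra.smul_def]
    field_simp
  have hmk (s : F) : Projectivization.mk F _ (momentVector_ne_zero (c.map scale) (some s)) =
      Projectivization.mk F (s • a - b)⁻¹ (inv_ne_zero (hb s)) :=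
    (Projectivization.mk_eq_mk_iff' F _ _ _ _).2 ⟨_, (hsome s).symm⟩
  refine ⟨c.map scale, ?_⟩
  rw [pointsOf_span_pair ha hb, Set.image_insert_eq, ← Set.range_comp, momentCurve_eq_insert]
  simp only [Function.comp_def, inversion_mk, hnone, hmk]

theorem IsLine.exists_inversion_image_eq_momentCurve [Finite L] {p k d : ℕ} (hp : p.Prime)
    (hL : finrank F L = p ^ (k + 1)) (hd : d + 1 = p ^ (k + 1)) {M : IntermediateField F L}
    (hM : finrank F M = p ^ k) {l : Set (ℙ F L)} (hl : IsLine l)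
    (hs : IsScattered l (desarguesianSpread M)) :
    ∃ c : Basis (Fin (d + 1)) F L, inversion '' l = momentCurve c := by
  obtain ⟨a, b, hab, rfl⟩ := hl.exists_eq_pointsOf_span_pair
  have ha : a ≠ 0 := hab.ne_zero 0
  have hθ : b / a ∉ M := fun hm => by
    obtain ⟨s, hsab⟩ := IntermediateField.mem_bot.1 <|
      isScattered_pointsOf_iff.1 hs a (Submodule.subset_span (by simp)) ha _ hm
        (Submodule.subset_span (by simp [ha]))
    refine (LinearIndependent.pair_iff' ha).1 hab s ?_
    rw [Algebra.smul_def, hsab, div_mul_cancel₀ _ ha]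
  exact FieldInversion.exists_inversion_image_eq_momentCurve (hL.trans hd.symm) hab
    (adjoin_simple_eq_top_of_notMem hp hL hM hθ)

end Inversion

section SemilinearMaps

variable {K V : Type*} [Field K] [AddCommGroup V] [Module K V] {σ : K →+* K}

theorem exists_semilinearMap_notMem_span (hV : finrank K V = 2) (hσ : ∀ x, σ (σ x) = x) {κ : K}
    (hκ : σ κ ≠ κ) : ∃ J : V →ₛₗ[σ] V, ∀ v, v ≠ 0 → J v ∉ Submodule.span K {v} := by
  have : Module.Finite K V := finite_of_finrank_pos (by omega)
  let e := finBasisOfFinrankEq K V hV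
  let J : V →ₛₗ[σ] V :=
    { toFun := fun v => σ (e.repr v 1) • e 0 + (κ * σ (e.repr v 0)) • e 1
      map_add' := fun v w => by
        simp only [map_add, Finsupp.add_apply, mul_add, add_smul]
        abel
      map_smul' := fun c v => by
        simp only [map_smul, Finsupp.smul_apply, smul_eq_mul, map_mul, smul_add, smul_smul,
          mul_left_comm κ] }
  refine ⟨J, fun v hv hJv => hv ?_⟩
  obtain ⟨c, hc⟩ := Submodule.mem_span_singleton.1 hJv
  have h0 : c * e.repr v 0 = σ (e.repr v 1) := by
    simpa [J, Finsupp.single_apply] using congrArg (fun w => e.repr w 0) hc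
  have h1 : c * e.repr v 1 = κ * σ (e.repr v 0) := by
    simpa [J, Finsupp.single_apply] using congrArg (fun w => e.repr w 1) hc
  have h1' : e.repr v 1 = σ c * σ (e.repr v 0) := by rw [← map_mul, h0, hσ]
  have hnorm : (c * σ c - κ) * σ (e.repr v 0) = 0 := by
    rw [h1'] at h1
    linear_combination h1
  -- The norm `c * σ c` is fixed by `σ`, whereas `κ` is not.
  have hne : c * σ c - κ ≠ 0 := fun h => hκ (by
    rw [← sub_eq_zero.1 h, map_mul, hσ, mul_comm])
  have hv0 : σ (e.repr v 0) = 0 := (mul_eq_zero.1 hnorm).resolve_left hne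
  refine e.ext_elem fun i => ?_
  fin_cases i
  · simpa using hv0
  · simp [h1', hv0]

theorem eq_and_map_eq_of_smul_add_eq {J : V →ₛₗ[σ] V} {v : V} (hJv : J v ∉ Submodule.span K {v})
    {m r : K} (h : m • (v + J v) = r • v + J (r • v)) : m = r ∧ σ r = r := by
  have hcomb : (m - σ r) • J v = (r - m) • v := by
    rw [smul_add, map_smulₛₗ] at h
    rw [sub_smul, sub_smul, sub_eq_sub_iff_add_eq_add, add_comm, h]
  have hmσ : m = σ r := by
    by_contra hne
    refine hJv (((Submodule.span K {v}).smul_mem_iff (sub_ne_zero.2 hne)).1 ?_)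
    rw [hcomb]
    exact Submodule.smul_mem _ _ (Submodule.mem_span_singleton_self v)
  have hv : v ≠ 0 := by
    rintro rfl
    exact hJv (by simp)
  have hrm : r = m := by
    rw [hmσ, sub_self, zero_smul, eq_comm, smul_eq_zero_iff_left hv, sub_eq_zero] at hcomb
    exact hcomb.trans hmσ.symm
  exact ⟨hrm.symm, hmσ.symm.trans hrm.symm⟩

theorem exists_linearEquiv_eq_and_map_eq_of_smul_eq {F : Type*} [Field F] [Algebra F K] [Module F V]
    [IsScalarTower F K V] [FiniteDimensional F V] (hV : finrank K V = 2) {σ : K →ₐ[F] K}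
    (hσ : ∀ x, σ (σ x) = x) {κ : K} (hκ : σ κ ≠ κ) :
    ∃ φ : V ≃ₗ[F] V, ∀ v, v ≠ 0 → ∀ m r : K, m • φ v = φ (r • v) → m = r ∧ σ r = r := by
  obtain ⟨J, hJ⟩ := exists_semilinearMap_notMem_span hV (σ := (σ : K →+* K)) hσ hκ
  let φ : V →ₗ[F] V :=
    { toFun := fun v => v + J v
      map_add' := fun v w => by rw [map_add, add_add_add_comm]
      map_smul' := fun c v => by
        rw [← algebraMap_smul K c v, map_smulₛₗ, RingHom.id_apply, RingHom.coe_coe, σ.commutes,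
          algebraMap_smul, algebraMap_smul, smul_add] }
  have hφ (v : V) (hv : v ≠ 0) (m r : K) (h : m • φ v = φ (r • v)) : m = r ∧ σ r = r :=
    eq_and_map_eq_of_smul_add_eq (hJ v hv) h
  have hinj : Function.Injective φ := by
    rw [← LinearMap.ker_eq_bot, LinearMap.ker_eq_bot']
    intro v hv
    by_contra hv0
    exact one_ne_zero (hφ v hv0 1 0 (by rw [hv, zero_smul, smul_zero, map_zero])).1
  exact ⟨.ofInjectiveEndo φ hinj, hφ⟩

end SemilinearMaps

section LineParametrization

variable {F K V V' : Type*} [Field F] [Field K] [Algebra F K] [AddCommGroup V] [Module F V]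
  [Module K V] [IsScalarTower F K V] [AddCommGroup V'] [Module F V'] (φ : V ≃ₗ[F] V')

/-- The parametrization `c ↦ φ (c v)` of the image under `φ` of the one-dimensional `K`-subspace
`P = K v`, where `v` is the representative of `P` chosen by `Projectivization.rep`. -/
noncomputable def lineParam (P : ℙ K V) : K →ₗ[F] V' :=
  φ.toLinearMap ∘ₗ (LinearMap.toSpanSingleton K V P.rep).restrictScalars F

theorem lineParam_apply (P : ℙ K V) (c : K) : lineParam φ P c = φ (c • P.rep) :=
  rfl

theorem lineParam_injective (P : ℙ K V) : Function.Injective (lineParam φ P) :=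
  φ.injective.comp (smul_left_injective K P.rep_nonzero)

variable (K) in
theorem exists_lineParam_eq {x : V'} (hx : x ≠ 0) :
    ∃ (P : ℙ K V) (c : K), c ≠ 0 ∧ lineParam φ P c = x := by
  have hx' : φ.symm x ≠ 0 := φ.symm.map_ne_zero_iff.2 hx
  obtain ⟨c, hc⟩ := Projectivization.exists_smul_eq_mk_rep K (φ.symm x) hx'
  refine ⟨.mk K _ hx', (c⁻¹ : Kˣ), c⁻¹.ne_zero, ?_⟩
  rw [lineParam_apply, ← hc, ← Units.smul_def, inv_smul_smul, φ.apply_symm_apply]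

theorem eq_and_eq_of_lineParam_eq {P Q : ℙ K V} {c d : K} (hc : c ≠ 0)
    (h : lineParam φ P c = lineParam φ Q d) : P = Q ∧ c = d := by
  have hcd : c • P.rep = d • Q.rep := φ.injective h
  have hPQ : P = Q := by
    rw [← P.mk_rep, ← Q.mk_rep, Projectivization.mk_eq_mk_iff']
    exact ⟨c⁻¹ * d, by rw [mul_smul, ← hcd, inv_smul_smul₀ hc]⟩
  subst hPQ
  exact ⟨rfl, lineParam_injective φ P h⟩

end LineParametrization

section ScatteredSpreads

variable {F L : Type*} [Field F] [Field L] [Algebra F L] {M : IntermediateField F L}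

/-- The line spreads of the projective space of `L` over `F` whose lines are scattered with respect
to the Desarguesian spread of `M`, in terms of the underlying two-dimensional subspaces: each of
these meets every `M`-line `M z` in a subspace of dimension at most one. -/
structure IsScatteredSpread (M : IntermediateField F L) (S : Set (Submodule F L)) : Prop where
  finrank_eq_two : ∀ W ∈ S, finrank F W = 2
  mem_bot_of_mul_mem : ∀ W ∈ S, ∀ x ∈ W, x ≠ 0 → ∀ m ∈ M, m * x ∈ W →
    m ∈ (⊥ : IntermediateField F L)
  existsUnique_mem : ∀ x : L, x ≠ 0 → ∃! W, W ∈ S ∧ x ∈ W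

theorem IsScatteredSpread.isScattered {S : Set (Submodule F L)} (hS : IsScatteredSpread M S) :
    ∀ l ∈ pointsOf '' S, IsScattered l (desarguesianSpread M) := by
  rintro _ ⟨W, hW, rfl⟩
  exact isScattered_pointsOf_iff.2 (hS.mem_bot_of_mul_mem W hW)

theorem IsScatteredSpread.isLineSpread {S : Set (Submodule F L)} (hS : IsScatteredSpread M S) :
    IsLineSpread (pointsOf '' S) := by
  refine ⟨?_, ?_, fun P => ?_⟩
  · rintro _ ⟨W, hW, rfl⟩
    exact ⟨W, hS.finrank_eq_two W hW, rfl⟩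
  · rintro ⟨W, hW, hempty⟩
    have hne : W ≠ ⊥ := by
      rintro rfl
      simpa using hS.finrank_eq_two _ hW
    obtain ⟨v, hv, hv0⟩ := W.exists_mem_ne_zero_of_ne_bot hne
    exact Set.eq_empty_iff_forall_notMem.1 hempty _ ((mk_mem_pointsOf hv0).2 hv)
  · induction P with | h v hv =>
    obtain ⟨W, ⟨hW, hvW⟩, huniq⟩ := hS.existsUnique_mem v hv
    refine ⟨pointsOf W, ⟨⟨W, hW, rfl⟩, (mk_mem_pointsOf hv).2 hvW⟩, ?_⟩
    rintro _ ⟨⟨W', hW', rfl⟩, hvW'⟩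
    rw [huniq W' ⟨hW', (mk_mem_pointsOf hv).1 hvW'⟩]

theorem isScatteredSpread_bot (hL : finrank F L = 2) :
    IsScatteredSpread (⊥ : IntermediateField F L) {⊤} where
  finrank_eq_two := by simp [hL]
  mem_bot_of_mul_mem _ _ _ _ _ _ hm _ := hm
  existsUnique_mem _ _ := ⟨⊤, by simp, by simp⟩

theorem IsScatteredSpread.lift {M₀ : IntermediateField F M} {S₀ : Set (Submodule F M)}
    (hS₀ : IsScatteredSpread M₀ S₀) {φ : L ≃ₗ[F] L}
    (hφ : ∀ v, v ≠ 0 → ∀ m r : M, m • φ v = φ (r • v) → m = r ∧ r ∈ M₀) :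
    IsScatteredSpread M {W | ∃ P : ℙ M L, ∃ W₀ ∈ S₀, W = W₀.map (lineParam φ P)} where
  finrank_eq_two := by
    rintro _ ⟨P, W₀, hW₀, rfl⟩
    rw [← hS₀.finrank_eq_two W₀ hW₀]
    exact (Submodule.equivMapOfInjective _ (lineParam_injective φ P) W₀).finrank_eq.symm
  mem_bot_of_mul_mem := by
    rintro _ ⟨P, W₀, hW₀, rfl⟩ _ ⟨c, hc, rfl⟩ hx m hm ⟨d, hd, hdm⟩
    have hc0 : c ≠ 0 := by
      rintro rfl
      exact hx (map_zero _)
    have hcP : c • P.rep ≠ 0 := fun h => hx (by rw [lineParam_apply, h, map_zero])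
    have hmul : (⟨m, hm⟩ : M) • φ (c • P.rep) = φ ((d / c) • c • P.rep) := by
      rw [smul_smul, div_mul_cancel₀ _ hc0]
      exact hdm.symm
    obtain ⟨hmd, hd₀⟩ := hφ _ hcP _ _ hmul
    have hbot : d / c ∈ (⊥ : IntermediateField F M) :=
      hS₀.mem_bot_of_mul_mem W₀ hW₀ c hc hc0 _ hd₀ (by rwa [div_mul_cancel₀ _ hc0])
    obtain ⟨s, hs⟩ := IntermediateField.mem_bot.1 hbot
    exact IntermediateField.mem_bot.2 ⟨s, congrArg Subtype.val (hs.trans hmd.symm)⟩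
  existsUnique_mem x hx := by
    obtain ⟨P, c, hc, rfl⟩ := exists_lineParam_eq M φ hx
    obtain ⟨W₀, ⟨hW₀, hcW⟩, huniq⟩ := hS₀.existsUnique_mem c hc
    refine ⟨W₀.map (lineParam φ P), ⟨⟨P, W₀, hW₀, rfl⟩, c, hcW, rfl⟩, ?_⟩
    rintro _ ⟨⟨Q, W₁, hW₁, rfl⟩, d, hd, hdc⟩
    obtain ⟨rfl, rfl⟩ := eq_and_eq_of_lineParam_eq φ hc hdc.symm
    rw [huniq W₁ ⟨hW₁, hd⟩]

end ScatteredSpreads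

section Existence

theorem exists_mem_center_orderOf_eq {G : Type*} [Group G] [Finite G] [Nontrivial G] {p : ℕ}
    [Fact p.Prime] (hG : IsPGroup p G) : ∃ g ∈ Subgroup.center G, orderOf g = p := by
  have := hG.center_nontrivial
  obtain ⟨n, hn, hcard⟩ := (hG.to_subgroup (Subgroup.center G)).nontrivial_iff_card.1 this
  obtain ⟨g, hg⟩ := exists_prime_orderOf_dvd_card' (G := Subgroup.center G) p
    (hcard ▸ dvd_pow_self p hn.ne')
  exact ⟨g, g.2, by rw [Subgroup.orderOf_coe, hg]⟩

theorem zpowers_normal_of_mem_center {G : Type*} [Group G] {g : G}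
    (hg : g ∈ Subgroup.center G) : (Subgroup.zpowers g).Normal :=
  ⟨fun n hn x => by
    have hcomm := Subgroup.mem_center_iff.1 (Subgroup.zpowers_le.2 hg hn) x
    rwa [hcomm, mul_inv_cancel_right]⟩

theorem mem_fixedField_zpowers_iff {F M : Type*} [Field F] [Field M] [Algebra F M] {σ : Gal(M/F)}
    {x : M} : x ∈ IntermediateField.fixedField (Subgroup.zpowers σ) ↔ σ x = x := by
  rw [IntermediateField.mem_fixedField_iff]
  refine ⟨fun h => h σ (Subgroup.mem_zpowers σ), fun hx => ?_⟩
  exact Subgroup.zpowers_le (H := MulAction.stabilizer Gal(M/F) x).2 hx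

theorem exists_involution_fixedField {F M : Type*} [Field F] [Field M] [Algebra F M]
    [IsGalois F M] {k : ℕ} (hM : finrank F M = 2 ^ (k + 1)) :
    ∃ (σ : Gal(M/F)) (M₀ : IntermediateField F M), (∀ x, σ (σ x) = x) ∧ (∃ κ, σ κ ≠ κ) ∧
      (∀ x, σ x = x → x ∈ M₀) ∧ IsGalois F M₀ ∧ finrank F M₀ = 2 ^ k := by
  have : FiniteDimensional F M := finite_of_finrank_pos (by rw [hM]; positivity)
  have hcard : Nat.card Gal(M/F) = 2 ^ (k + 1) := by rw [IsGalois.card_aut_eq_finrank, hM]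
  have : Nontrivial Gal(M/F) := Finite.one_lt_card_iff_nontrivial.1 (by
    rw [hcard]
    exact Nat.one_lt_two_pow k.succ_ne_zero)
  obtain ⟨σ, hσ_center, hσ⟩ := exists_mem_center_orderOf_eq (IsPGroup.of_card hcard)
  -- Centrality of `σ` makes its fixed field Galois over `F`.
  have := zpowers_normal_of_mem_center hσ_center
  let M₀ := IntermediateField.fixedField (Subgroup.zpowers σ)
  have hM₀ : finrank F M₀ = 2 ^ k := by
    have h := finrank_mul_finrank F M₀ M
    rw [IntermediateField.finrank_fixedField_eq_card, Nat.card_zpowers, hσ, hM, pow_succ] at h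
    exact Nat.eq_of_mul_eq_mul_right two_pos h
  refine ⟨σ, M₀, AlgEquiv.congr_fun ((orderOf_eq_prime_iff.1 hσ).1 ▸ (pow_two σ).symm), ?_,
    fun x => mem_fixedField_zpowers_iff.2, inferInstance, hM₀⟩
  by_contra! h
  exact (orderOf_eq_prime_iff.1 hσ).2 (AlgEquiv.ext h)

theorem exists_isScatteredSpread {F : Type*} [Field F] (k : ℕ) :
    ∀ {L : Type*} [Field L] [Algebra F L], finrank F L = 2 ^ (k + 1) →
      ∀ (M : IntermediateField F L) [IsGalois F M], finrank F M = 2 ^ k →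
        ∃ S, IsScatteredSpread M S := by
  induction k with
  | zero =>
    intro L _ _ hL M _ hM
    obtain rfl : M = ⊥ := IntermediateField.finrank_eq_one_iff.1 (by rw [hM, pow_zero])
    exact ⟨{⊤}, isScatteredSpread_bot (by rw [hL, zero_add, pow_one])⟩
  | succ k ih =>
    intro L _ _ hL M _ hM
    have : FiniteDimensional F L := finite_of_finrank_pos (by rw [hL]; positivity)
    have hML : finrank M L = 2 := by
      have h := finrank_mul_finrank F M L
      rw [hM, hL, pow_succ 2 (k + 1)] at h
      exact Nat.eq_of_mul_eq_mul_left (by positivity) h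
    obtain ⟨σ, M₀, hσ, ⟨κ, hκ⟩, hfix, _, hM₀⟩ := exists_involution_fixedField hM
    obtain ⟨S₀, hS₀⟩ := ih hM M₀ hM₀
    obtain ⟨φ, hφ⟩ := exists_linearEquiv_eq_and_map_eq_of_smul_eq hML (σ := (σ : M →ₐ[F] M)) hσ hκ
    exact ⟨_, hS₀.lift fun v hv m r h => (hφ v hv m r h).imp_right (hfix r)⟩

end Existence

end FieldInversion

theorem mainTheorem1 {F L : Type*} [Field F] [Finite F] [Field L] [Algebra F L]
    (q k : ℕ) (hq : Nat.card F = q) (hk : 1 < k) (hL : Module.finrank F L = 2 ^ k)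
    (M : IntermediateField F L) (hM : Module.finrank F M = 2 ^ (k - 1)) :
    (∃ S : Set (Set (ℙ F L)), FieldInversion.IsLineSpread S ∧
      ∀ l ∈ S, FieldInversion.IsScattered l (FieldInversion.desarguesianSpread M)) ∧
    ∀ S : Set (Set (ℙ F L)), FieldInversion.IsLineSpread S →
      (∀ l ∈ S, FieldInversion.IsScattered l (FieldInversion.desarguesianSpread M)) →
      Setoid.IsPartition (FieldInversion.inversionImage S) ∧
      (2 ^ k - 1 ≤ q → ∀ C ∈ FieldInversion.inversionImage S,
        FieldInversion.IsNRCOfDegree (2 ^ k - 1) C) ∧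
      (q < 2 ^ k - 1 → ∀ C ∈ FieldInversion.inversionImage S,
        FieldInversion.IsIndependentTuple (q + 1) C) := by
  subst hq
  have hd : 2 ^ k - 1 + 1 = 2 ^ k := Nat.sub_add_cancel Nat.one_le_two_pow
  obtain ⟨k, rfl⟩ := Nat.exists_eq_add_one_of_ne_zero (by omega : k ≠ 0)
  rw [Nat.add_sub_cancel] at hM
  have : FiniteDimensional F L := Module.finite_of_finrank_pos (by rw [hL]; positivity)
  have : Finite L := Module.finite_of_finite F
  refine ⟨?_, fun S hS hscattered => ?_⟩
  · obtain ⟨S, hS⟩ := FieldInversion.exists_isScatteredSpread k hL M hM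
    exact ⟨_, hS.isLineSpread, hS.isScattered⟩
  have hcurve : ∀ C ∈ FieldInversion.inversionImage S,
      ∃ c : Module.Basis (Fin (2 ^ (k + 1) - 1 + 1)) F L,
        C = FieldInversion.momentCurve c := by
    rintro _ ⟨l, hl, rfl⟩
    exact (hS.1 l hl).exists_inversion_image_eq_momentCurve Nat.prime_two hL hd hM
      (hscattered l hl)
  refine ⟨FieldInversion.isPartition_inversionImage hS.2, fun hq C hC => ?_, fun hq C hC => ?_⟩
  · obtain ⟨c, rfl⟩ := hcurve C hC
    exact FieldInversion.isNRCOfDegree_momentCurve c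
      (by rwa [ENat.card_eq_coe_natCard, Nat.cast_le])
  · obtain ⟨c, rfl⟩ := hcurve C hC
    exact FieldInversion.isIndependentTuple_momentCurve c hq.le
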